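/- All order types are types of linear orders, $\varphi\leqslant\psi$ means that an order of type $\varphi$ embeds into an order of type $\psi$, $\varphi^*$ is the reverse of $\varphi$, and products and powers of ordinals are ordinal products and powers (so $\omega_1\omega$ is the type of $\omega$ consecutive copies of $\omega_1$). For an infinite cardinal $\kappa$, an order type is called $\kappa$-dense if it has more than one element and, for all elements $a<b$, the open interval $(a,b)$ has at least $\kappa$ elements; for regular $\kappa$, an order type $\varphi$ is called $\kappa$-scattered if there is no $\kappa$-dense order type $\psi\leqslant\varphi$. An order type is called $\langle\aleph_1,\aleph_1\rangle$-scattered if an order $P$ of that type can be written as $P=\bigcup_{\zeta<\nu}P_\zeta$ for some cardinal $\nu<\aleph_1$, where each suborder $P_\zeta$ is of $\aleph_1$-scattered type. For order types $\tau,\varphi_0,\psi_0,\varphi_1$, the relation $\tau\longrightarrow(\varphi_0\vee\psi_0,\varphi_1)^2$ means that for every order $P$ of type $\tau$ and every colouring $f:[P]^2\to\{0,1\}$ of the two-element subsets of $P$ there is either a suborder of $P$ of type $\varphi_0$ or $\psi_0$ all of whose two-element subsets have colour $0$, or a suborder of $P$ of type $\varphi_1$ all of whose two-element subsets have colour $1$;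 $\tau\longrightarrow(\varphi_0,\varphi_1)^2$ is the same relation without the alternative $\psi_0$, and $\not\longrightarrow$ denotes its negation. Theorem. Assume that $\omega_1\omega\not\longrightarrow(\omega_1\omega,3)^2$, and let $\tau$ be an $\langle\aleph_1,\aleph_1\rangle$-scattered linear order type of size at most $\aleph_1$. Then $\tau\not\longrightarrow\bigl(\omega_1^{\omega}\vee(\omega_1^{\omega})^*,3\bigr)^2$. -/

import Mathlib

open Cardinal Ordinal

universe u

noncomputable section

namespace OrderPartition

/-- The order type of (a well-order of type) the ordinal `α`. -/
def ordinalType (α : Ordinal.{u}) : OrderType.{u} :=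
  OrderType.type α.ToType

/-- The reverse `φ*` of an order type `φ`. -/
def reverse (φ : OrderType.{u}) : OrderType.{u} :=
  OrderType.type (φ.ToType)ᵒᵈ

/-- An order type `φ` is `κ`-dense if it has more than one element and every open interval
`(a, b)` with `a < b` has at least `κ` elements. -/
def IsDense (κ : Cardinal.{u}) (φ : OrderType.{u}) : Prop :=
  1 < #φ.ToType ∧ ∀ a b : φ.ToType, a < b → κ ≤ #(Set.Ioo a b)

/-- An order type is `κ`-scattered if no `κ`-dense order type embeds into it. -/
def IsScattered (κ : Cardinal.{u}) (φ : OrderType.{u}) : Prop :=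
  ¬ ∃ τ : OrderType.{u}, IsDense κ τ ∧ τ ≤ φ

/-- An order type is `⟨κ, μ⟩`-scattered if an order of that type is the union of a sequence,
indexed by some `ν < μ`, of `κ`-scattered suborders. -/
def IsPairScattered (κ μ : Cardinal.{u}) (φ : OrderType.{u}) : Prop :=
  ∃ ν : Cardinal.{u}, ν < μ ∧ ∃ P : ν.ord.ToType → Set φ.ToType,
    (∀ ζ, IsScattered κ (OrderType.type (P ζ))) ∧ ⋃ ζ, P ζ = Set.univ

/-- The partition relation with alternatives
`τ ⟶ (φ₀₀ ∨ ⋯ ∨ φ₀ₖ, …, φₙ₀ ∨ ⋯ ∨ φₙₗ)ʳ`, where `Φ i = {φᵢ₀, φᵢ₁, …}` is the set of alternatives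
for the colour `i`: whenever the `r`-element subsets of an order `P` of type `τ` are coloured,
there are a colour `i` and a suborder `Q` of `P` whose order type belongs to `Φ i` such that all
`r`-element subsets of `Q` have colour `i`. -/
def Arrow (τ : OrderType.{u}) {k : ℕ} (Φ : Fin k → Set OrderType.{u}) (r : ℕ) : Prop :=
  ∀ (P : Type u) [LinearOrder P], OrderType.type P = τ →
    ∀ f : {s : Finset P // s.card = r} → Fin k,
      ∃ (i : Fin k) (Q : Set P), OrderType.type Q ∈ Φ i ∧
        ∀ s : {s : Finset P // s.card = r}, (s.1 : Set P) ⊆ Q → f s = i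

end OrderPartition

end

noncomputable section

namespace OrderPartition

/-! The order splits into countably many pieces, the `n`-th omitting `ω₁ ^ (n + 1)` and its reverse
(`HasPowRank`). For scattered orders this comes from a Hausdorff-style condensation
(`hasPowRank_univ_of_isScattered`), and countable unions preserve it. Send the `n`-th piece
injectively into the `n`-th copy of `ω₁` in `ω₁ * ω` and pull back the bad colouring. A set of type
`ω₁ ^ ω` or its reverse is not covered by finitely many pieces and a countable set, so it meets
infinitely many pieces uncountably, and its image has type `ω₁ * ω`. The map need not respect order:
colour 1 only asks for three points. -/

variable {L : Type u} [LinearOrder L]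

/-! ### Sets omitting finite powers of `ω₁` -/

/-- No suborder of `A` has the type of the ordinal power `ω₁ ^ n`. -/
def OmitsPow (n : ℕ) (A : Set L) : Prop :=
  ∀ e : Ordinal.{u} → L, StrictMonoOn e (Set.Iio (ω₁ ^ n)) →
    ¬ Set.MapsTo e (Set.Iio (ω₁ ^ n)) A

theorem omega_one_pow_pos (n : ℕ) : (0 : Ordinal.{u}) < ω₁ ^ n :=
  pow_pos (omega_pos 1) n

theorem OmitsPow.subset {n : ℕ} {A B : Set L} (h : OmitsPow n B) (hAB : A ⊆ B) :
    OmitsPow n A :=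
  fun e he hA => h e he (hA.mono_right hAB)

theorem OmitsPow.mono {n m : ℕ} {A : Set L} (h : OmitsPow n A) (hnm : n ≤ m) :
    OmitsPow m A := by
  have hsub : Set.Iio ((ω₁ : Ordinal.{u}) ^ n) ⊆ Set.Iio (ω₁ ^ m) :=
    Set.Iio_subset_Iio (pow_le_pow_right₀ (Order.one_le_iff_pos.2 (omega_pos 1)) hnm)
  exact fun e he hA => h e (he.mono hsub) (hA.mono_left hsub)

theorem mul_add_lt_mul {a b x y : Ordinal.{u}} (hx : x < b) (hy : y < a) :
    a * x + y < a * b :=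
  lt_mul_iff.2 ⟨x, hx, y, hy, rfl⟩

theorem mul_add_lt_mul_add {a x x' y : Ordinal.{u}} (y' : Ordinal.{u}) (hx : x < x') (hy : y < a) :
    a * x + y < a * x' + y' :=
  (mul_add_lt_mul hx hy).trans_le le_self_add

/-- View `ω₁ ^ (a + b)` as `ω₁ ^ b` blocks of type `ω₁ ^ a`. Either some block lies in `A`, or one
point outside `A` from each block gives a copy of `ω₁ ^ b` in `B`. -/
theorem OmitsPow.union {a b : ℕ} {A B : Set L} (hA : OmitsPow a A) (hB : OmitsPow b B) :
    OmitsPow (a + b) (A ∪ B) := by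
  intro e he hAB
  rw [pow_add] at he hAB
  by_cases hex : ∃ x < (ω₁ : Ordinal.{u}) ^ b, ∀ y < (ω₁ : Ordinal.{u}) ^ a,
      e (ω₁ ^ a * x + y) ∈ A
  · obtain ⟨x, hx, hy⟩ := hex
    refine hA (fun y => e (ω₁ ^ a * x + y)) (fun y hy z hz hyz => ?_) hy
    exact he (mul_add_lt_mul hx hy) (mul_add_lt_mul hx hz) (by gcongr)
  · push Not at hex
    choose! y hy hyA using hex
    refine hB (fun x => e (ω₁ ^ a * x + y x)) (fun x hx z hz hxz => ?_) (fun x hx => ?_)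
    · exact he (mul_add_lt_mul hx (hy x hx)) (mul_add_lt_mul hz (hy z hz))
        (mul_add_lt_mul_add _ hxz (hy x hx))
    · exact (hAB (mul_add_lt_mul hx (hy x hx))).resolve_left (hyA x hx)

theorem countable_iff_mk_lt_aleph_one {α : Type*} {s : Set α} : s.Countable ↔ #s < ℵ₁ := by
  rw [lt_aleph_one_iff, le_aleph0_iff_set_countable]

theorem countable_Iio_of_lt_omega_one {a : Ordinal.{u}} (ha : a < ω₁) : (Set.Iio a).Countable := by
  rw [← le_aleph0_iff_set_countable, Cardinal.mk_Iio_ordinal, lift_le_aleph0, ← lt_aleph_one_iff]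
  rwa [← ord_aleph, lt_ord] at ha

theorem not_countable_Iio_omega_one : ¬ (Set.Iio (ω₁ : Ordinal.{u})).Countable := by
  rw [← le_aleph0_iff_set_countable, Cardinal.mk_Iio_ordinal, lift_le_aleph0, ← lt_aleph_one_iff]
  simp

theorem omitsPow_of_countable {A : Set L} (hA : A.Countable) : OmitsPow 1 A := by
  intro e he heA
  rw [pow_one] at he heA
  exact not_countable_Iio_omega_one (heA.countable_of_injOn he.injOn hA)

theorem cof_omega_one_pow_succ (n : ℕ) : ((ω₁ : Ordinal.{u}) ^ (n + 1)).cof = ℵ₁ := by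
  rw [pow_succ, cof_map_of_isNormal (isNormal_mul_right (omega_one_pow_pos n))
    (isSuccLimit_omega 1), cof_omega_one]

theorem omega_one_pow_add_lt {n : ℕ} {a b : Ordinal.{u}} (ha : a < ω₁ ^ n) (hb : b < ω₁ ^ n) :
    a + b < ω₁ ^ n := by
  rw [← opow_natCast] at *
  exact isPrincipal_add_opow_of_isPrincipal_add (isPrincipal_add_omega 1) _ ha hb

/-- Otherwise each of the countably many values is taken only on a bounded set, and cofinality `ℵ₁`
bounds all these sets at once. -/
theorem exists_const_of_monotoneOn {n : ℕ} {g : Ordinal.{u} → Ordinal.{u}}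
    (hg : MonotoneOn g (Set.Iio (ω₁ ^ (n + 1)))) {b : Ordinal.{u}} (hb : b < ω₁)
    (hgb : ∀ x < ω₁ ^ (n + 1), g x < b) :
    ∃ d < (ω₁ : Ordinal.{u}) ^ (n + 1), ∀ x < ω₁ ^ (n + 1), d ≤ x → g x = g d := by
  by_contra! hcon
  have hbd : ∀ v, ∃ c < (ω₁ : Ordinal.{u}) ^ (n + 1), ∀ x < ω₁ ^ (n + 1), g x = v → x ≤ c := by
    intro v
    by_cases hv : ∃ d < (ω₁ : Ordinal.{u}) ^ (n + 1), g d = v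
    · obtain ⟨d, hd, rfl⟩ := hv
      obtain ⟨c, hc, hdc, hne⟩ := hcon d hd
      refine ⟨c, hc, fun x hx hxd => le_of_not_gt fun hcx => hne ?_⟩
      exact le_antisymm (hxd ▸ hg hc hx hcx.le) (hg hd hc hdc)
    · push Not at hv
      exact ⟨0, omega_one_pow_pos _, fun x hx hxv => absurd hxv (hv x hx)⟩
  choose c hc hcb using hbd
  have hs : sSup (c '' Set.Iio b) < ω₁ ^ (n + 1) := by
    refine sSup_lt_of_lt_cof ?_ ?_
    · rw [← lift_cof, cof_omega_one_pow_succ]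
      rw [lift_aleph, Ordinal.lift_one]
      exact countable_iff_mk_lt_aleph_one.1 ((countable_Iio_of_lt_omega_one hb).image c)
    · rintro _ ⟨v, -, rfl⟩
      exact hc v
  have hs' : sSup (c '' Set.Iio b) + 1 < ω₁ ^ (n + 1) :=
    omega_one_pow_add_lt hs (one_lt_pow₀ ((one_lt_omega0).trans_le (omega0_le_omega 1)) (by simp))
  have h1 := hcb _ _ hs' rfl
  have h2 : c (g (sSup (c '' Set.Iio b) + 1)) ≤ sSup (c '' Set.Iio b) :=
    le_csSup (bddAbove_of_small) ⟨_, hgb _ hs', rfl⟩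
  exact absurd (h1.trans h2) (by simp)

/-- The extra exponent provides a point above the initial segment `ω₁ ^ (n + 1)`, so `f` is bounded
there by a countable ordinal and constant on a tail, which again has type `ω₁ ^ (n + 1)`. -/
theorem OmitsPow.of_fibers_monotone {n : ℕ} {A : Set L} {f : L → Ordinal.{u}}
    (hf : MonotoneOn f A) (hfb : ∀ x ∈ A, f x < ω₁)
    (h : ∀ v, OmitsPow (n + 1) (A ∩ f ⁻¹' {v})) : OmitsPow (n + 2) A := by
  intro e he heA
  have hlt : (ω₁ : Ordinal.{u}) ^ (n + 1) < ω₁ ^ (n + 2) :=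
    pow_lt_pow_right₀ (one_lt_omega0.trans_le (omega0_le_omega 1)) (by simp)
  have hsub := Set.Iio_subset_Iio hlt.le
  have hm : MonotoneOn (f ∘ e) (Set.Iio (ω₁ ^ (n + 2))) :=
    fun x hx y hy hxy => hf (heA hx) (heA hy) (he.monotoneOn hx hy hxy)
  have hlim : f (e (ω₁ ^ (n + 1))) + 1 < ω₁ :=
    (isSuccLimit_omega 1).add_one_lt (hfb _ (heA hlt))
  obtain ⟨d, hd, hconst⟩ := exists_const_of_monotoneOn (hm.mono hsub) hlim
    (fun x hx => Order.lt_add_one_iff.2 (hm (hsub hx) hlt hx.le))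
  refine h (f (e d)) (fun x => e (d + x)) (fun x hx y hy hxy => ?_) (fun x hx => ?_)
  · exact he (hsub (omega_one_pow_add_lt hd hx)) (hsub (omega_one_pow_add_lt hd hy)) (by gcongr)
  · have hx' := omega_one_pow_add_lt hd hx
    exact ⟨heA (hsub hx'), hconst _ hx' le_self_add⟩

/-- From a point where `f` is minimal onwards `f` is constant, and that tail has the full type. -/
theorem OmitsPow.of_fibers_antitone {n : ℕ} {A : Set L} {f : L → Ordinal.{u}}
    (hf : AntitoneOn f A) (h : ∀ v, OmitsPow n (A ∩ f ⁻¹' {v})) : OmitsPow n A := by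
  intro e he heA
  have hne : (Set.Iio ((ω₁ : Ordinal.{u}) ^ n)).Nonempty := ⟨0, omega_one_pow_pos n⟩
  obtain ⟨d, hd, hmin⟩ := WellFounded.has_min (InvImage.wf (f ∘ e) wellFounded_lt) _ hne
  refine h (f (e d)) (fun x => e (d + x)) (fun x hx y hy hxy => ?_) (fun x hx => ?_)
  · exact he (omega_one_pow_add_lt hd hx) (omega_one_pow_add_lt hd hy) (by gcongr)
  · have hx' := omega_one_pow_add_lt hd hx
    refine ⟨heA hx', le_antisymm ?_ (not_lt.1 (hmin _ hx'))⟩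
    exact hf (heA hd) (heA hx') (he.monotoneOn hd hx' le_self_add)

/-- Neither `ω₁ ^ n` nor its reverse is the type of a suborder of `A`. -/
def OmitsPowBoth (n : ℕ) (A : Set L) : Prop :=
  OmitsPow n A ∧ OmitsPow n (OrderDual.ofDual ⁻¹' A)

theorem OmitsPowBoth.subset {n : ℕ} {A B : Set L} (h : OmitsPowBoth n B) (hAB : A ⊆ B) :
    OmitsPowBoth n A :=
  ⟨h.1.subset hAB, h.2.subset (Set.preimage_mono hAB)⟩

theorem OmitsPowBoth.mono {n m : ℕ} {A : Set L} (h : OmitsPowBoth n A) (hnm : n ≤ m) :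
    OmitsPowBoth m A :=
  ⟨h.1.mono hnm, h.2.mono hnm⟩

theorem OmitsPowBoth.dual {n : ℕ} {A : Set L} (h : OmitsPowBoth n A) :
    OmitsPowBoth n (OrderDual.ofDual ⁻¹' A) :=
  ⟨h.2, h.1⟩

theorem OmitsPowBoth.union {a b : ℕ} {A B : Set L} (hA : OmitsPowBoth a A)
    (hB : OmitsPowBoth b B) : OmitsPowBoth (a + b) (A ∪ B) :=
  ⟨hA.1.union hB.1, hA.2.union hB.2⟩

theorem omitsPowBoth_of_countable {A : Set L} (hA : A.Countable) : OmitsPowBoth 1 A :=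
  ⟨omitsPow_of_countable hA,
    omitsPow_of_countable (hA.preimage_of_injOn OrderDual.ofDual.injective.injOn)⟩

theorem OmitsPowBoth.of_fibers {n : ℕ} {A : Set L} {f : L → Ordinal.{u}}
    (hf : MonotoneOn f A) (hfb : ∀ x ∈ A, f x < ω₁)
    (h : ∀ v, OmitsPowBoth (n + 1) (A ∩ f ⁻¹' {v})) : OmitsPowBoth (n + 2) A := by
  refine ⟨.of_fibers_monotone hf hfb fun v => (h v).1, ?_⟩
  have hanti : AntitoneOn (f ∘ OrderDual.ofDual) (OrderDual.ofDual ⁻¹' A) :=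
    fun x hx y hy hxy => hf hy hx hxy
  exact (OmitsPow.of_fibers_antitone hanti fun v => (h v).2).mono (Nat.le_succ _)

/-! ### Ranked countable decompositions -/

/-- `X` is a countable union of sets, the `n`-th of which contains neither a copy of `ω₁ ^ (n + 1)`
nor one of its reverse. -/
def HasPowRank (X : Set L) : Prop :=
  ∃ r : L → ℕ, ∀ n, OmitsPowBoth (n + 1) (X ∩ r ⁻¹' {n})

theorem HasPowRank.subset {X Y : Set L} (h : HasPowRank Y) (hXY : X ⊆ Y) : HasPowRank X := by
  obtain ⟨r, hr⟩ := h
  exact ⟨r, fun n => (hr n).subset (Set.inter_subset_inter_left _ hXY)⟩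

theorem HasPowRank.dual {X : Set L} (h : HasPowRank X) :
    HasPowRank (OrderDual.ofDual ⁻¹' X) := by
  obtain ⟨r, hr⟩ := h
  exact ⟨r ∘ OrderDual.ofDual, fun n => (hr n).dual⟩

theorem hasPowRank_of_countable {X : Set L} (h : X.Countable) : HasPowRank X :=
  ⟨fun _ => 0, fun _ => (omitsPowBoth_of_countable (h.mono Set.inter_subset_left)).mono (by simp)⟩

theorem HasPowRank.iUnion {ι : Type*} [Countable ι] {X : ι → Set L}
    (h : ∀ i, HasPowRank (X i)) : HasPowRank (⋃ i, X i) := by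
  classical
  obtain ⟨c, hc⟩ := exists_injective_nat ι
  choose r hr using h
  have hex : ∀ x, ∃ m : ℕ, x ∈ ⋃ i, X i → ∃ i, x ∈ X i ∧ m = Nat.pair (c i) (r i x) := by
    intro x
    by_cases hx : x ∈ ⋃ i, X i
    · obtain ⟨i, hi⟩ := Set.mem_iUnion.1 hx
      exact ⟨_, fun _ => ⟨i, hi, rfl⟩⟩
    · exact ⟨0, fun h => absurd h hx⟩
  choose R hR using hex
  refine ⟨R, fun m => ?_⟩
  by_cases hm : ∃ i, c i = m.unpair.1
  · obtain ⟨i, hi⟩ := hm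
    refine ((hr i m.unpair.2).mono (Nat.succ_le_succ (Nat.unpair_right_le m))).subset ?_
    rintro x ⟨hx, rfl⟩
    obtain ⟨j, hj, hjR⟩ := hR x hx
    rw [hjR, Nat.unpair_pair] at hi
    obtain rfl := hc hi
    exact ⟨hj, by simp [hjR]⟩
  · refine (omitsPowBoth_of_countable (Set.countable_empty.mono ?_)).mono (by simp)
    rintro x ⟨hx, rfl⟩
    obtain ⟨j, hj, hjR⟩ := hR x hx
    exact hm ⟨j, by simp [hjR]⟩

theorem HasPowRank.biUnion {ι : Type*} {s : Set ι} (hs : s.Countable) {X : ι → Set L}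
    (h : ∀ i ∈ s, HasPowRank (X i)) : HasPowRank (⋃ i ∈ s, X i) := by
  have := hs.to_subtype
  rw [Set.biUnion_eq_iUnion]
  exact .iUnion fun i => h i i.2

theorem HasPowRank.union {X Y : Set L} (hX : HasPowRank X) (hY : HasPowRank Y) :
    HasPowRank (X ∪ Y) := by
  rw [Set.union_eq_iUnion]
  exact .iUnion fun b => by cases b <;> assumption

theorem HasPowRank.of_fibers {X : Set L} {f : L → Ordinal.{u}}
    (hf : MonotoneOn f X) (hfb : ∀ x ∈ X, f x < ω₁)
    (h : ∀ v, HasPowRank (X ∩ f ⁻¹' {v})) : HasPowRank X := by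
  choose r hr using h
  -- The shift pays for the exponent lost in `OmitsPowBoth.of_fibers`.
  refine ⟨fun x => r (f x) x + 1, fun m => ?_⟩
  cases m with
  | zero =>
    refine (omitsPowBoth_of_countable (Set.countable_empty.mono ?_)).mono (by simp)
    rintro x ⟨-, hx⟩
    simp at hx
  | succ n =>
    refine .of_fibers (f := f) (hf.mono Set.inter_subset_left) (fun x hx => hfb x hx.1) fun v => ?_
    refine (hr v n).subset ?_
    rintro x ⟨⟨hx, hxn⟩, rfl⟩
    exact ⟨⟨hx, rfl⟩, by simpa using hxn⟩

/-! ### Condensation of scattered orders -/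

theorem exists_injective_lt_omega_one {L : Type u} (hL : #L ≤ ℵ₁) :
    ∃ c : L → Ordinal.{u}, Function.Injective c ∧ ∀ x, c x < ω₁ := by
  have h : Cardinal.lift.{u + 1} #L ≤ Cardinal.lift.{u} #(Set.Iio (ω₁ : Ordinal.{u})) := by
    rw [Cardinal.mk_Iio_ordinal]
    simpa using hL
  obtain ⟨c⟩ := Cardinal.lift_mk_le'.1 h
  exact ⟨fun x => c x, Subtype.val_injective.comp c.injective, fun x => (c x).2⟩

/-- Map `x` to the least code of a point of `X` at or above `x`. This is monotone, and the fibre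
over the code of `y` lies in `Icc a y`. -/
theorem HasPowRank.of_Icc (hL : #L ≤ ℵ₁) {X : Set L} {a : L}
    (h : ∀ x ∈ X, a ≤ x ∧ HasPowRank (Set.Icc a x)) : HasPowRank X := by
  obtain ⟨c, hc, hcb⟩ := exists_injective_lt_omega_one hL
  have hne : ∀ x ∈ X, (c '' (X ∩ Set.Ici x)).Nonempty := fun x hx => ⟨_, x, ⟨hx, le_rfl⟩, rfl⟩
  have hmem := fun x hx => csInf_mem (hne x hx)
  refine .of_fibers (f := fun x => sInf (c '' (X ∩ Set.Ici x))) (fun x hx y hy hxy => ?_)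
    (fun x hx => ?_) (fun v => ?_)
  · refine csInf_le_csInf' (hne y hy) (Set.image_mono ?_)
    exact Set.inter_subset_inter_right _ (Set.Ici_subset_Ici.2 hxy)
  · obtain ⟨y, -, hy⟩ := hmem x hx
    exact hy ▸ hcb y
  · by_cases hv : ∃ y ∈ X, c y = v
    · obtain ⟨y, hyX, rfl⟩ := hv
      refine (h y hyX).2.subset ?_
      rintro x ⟨hx, hxv⟩
      obtain ⟨z, ⟨-, hz⟩, hzc⟩ := hmem x hx
      obtain rfl := hc (hzc.trans hxv)
      exact ⟨(h x hx).1, hz⟩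
    · refine hasPowRank_of_countable (Set.countable_empty.mono ?_)
      rintro x ⟨hx, hxv⟩
      obtain ⟨z, ⟨hzX, -⟩, hzc⟩ := hmem x hx
      exact hv ⟨z, hzX, hzc.trans hxv⟩

theorem HasPowRank.of_uIcc (hL : #L ≤ ℵ₁) (a : L) :
    HasPowRank {x | HasPowRank (Set.uIcc a x)} := by
  have h1 : HasPowRank ({x | HasPowRank (Set.uIcc a x)} ∩ Set.Ici a) :=
    .of_Icc hL (a := a) fun x hx => ⟨hx.2, hx.1.subset Set.Icc_subset_uIcc⟩
  have h2 : HasPowRank (OrderDual.ofDual ⁻¹' ({x | HasPowRank (Set.uIcc a x)} ∩ Set.Iic a)) := by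
    refine .of_Icc (L := Lᵒᵈ) hL (a := OrderDual.toDual a) fun x hx => ⟨hx.2, ?_⟩
    have := (hx.1.subset Set.Icc_subset_uIcc').dual
    rwa [← Set.Icc_toDual] at this
  refine (h1.union h2.dual).subset fun x hx => ?_
  rcases le_total a x with hax | hax
  exacts [.inl ⟨hx, hax⟩, .inr ⟨hx, hax⟩]

theorem isDense_type {κ : Cardinal.{u}} (h1 : 1 < #L)
    (h : ∀ a b : L, a < b → κ ≤ #(Set.Ioo a b)) : IsDense κ (OrderType.type L) := by
  obtain ⟨e⟩ := OrderType.type_eq_type.1 (OrderType.type_toType (OrderType.type L))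
  refine ⟨by rwa [mk_congr e.toEquiv], fun a b hab => ?_⟩
  rw [← mk_image_eq e.injective, e.image_Ioo]
  exact h _ _ (e.strictMono hab)

/-- Identify two points when the interval between them is ranked. If there are two or more classes,
their representatives form an `ℵ₁`-dense suborder: with only countably many between `a` and `b`,
countably many ranked classes would cover `Icc a b` and identify its endpoints. -/
theorem hasPowRank_univ_of_isScattered (hL : #L ≤ ℵ₁)
    (hs : IsScattered ℵ₁ (OrderType.type L)) : HasPowRank (Set.univ : Set L) := by
  let S : Setoid L :=
    { r := fun a b => HasPowRank (Set.uIcc a b)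
      iseqv :=
        { refl := fun a => by
            rw [Set.uIcc_self]
            exact hasPowRank_of_countable (Set.countable_singleton a)
          symm := fun h => by rwa [Set.uIcc_comm]
          trans := fun h h' => (h.union h').subset Set.uIcc_subset_uIcc_union_uIcc } }
  let p : L → L := fun x => (Quotient.mk S x).out
  have hp : ∀ x, HasPowRank (Set.uIcc (p x) x) := fun x => Quotient.mk_out (s := S) x
  have hpp : ∀ x y, HasPowRank (Set.uIcc x y) → p x = p y := fun x y h =>
    congrArg Quotient.out (Quotient.sound (s := S) h)
  let R : Set L := Set.range p
  have hpR : ∀ x ∈ R, p x = x := by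
    rintro _ ⟨x, rfl⟩
    exact hpp _ _ (hp x)
  by_cases hR : 1 < #R
  · refine absurd ⟨OrderType.type R, isDense_type hR fun a b hab => ?_,
      OrderType.type_le_type_iff.2 ⟨OrderEmbedding.subtype _⟩⟩ hs
    by_contra hlt
    have hcount : (Set.Ioo a b).Countable := countable_iff_mk_lt_aleph_one.2 (not_le.1 hlt)
    have hcount' : (Set.Icc a b).Countable := by
      rw [← Set.Ioo_union_both hab.le]
      exact hcount.union (Set.toFinite _).countable
    have hgood : HasPowRank (Set.Icc a.1 b.1) := by
      refine (HasPowRank.biUnion hcount' fun c _ => HasPowRank.of_uIcc hL c.1).subset ?_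
      intro x hx
      simp only [Set.mem_iUnion]
      refine ⟨⟨p x, x, rfl⟩, ⟨?_, ?_⟩, hp x⟩
      -- If `p x < a ≤ x`, then `a` lies between equivalent points, so it represents the same class
      -- as `p x`.
      · by_contra hax
        have hax : p x < a.1 := not_le.1 hax
        have := hpp _ _ ((hp x).subset (Set.uIcc_subset_uIcc_right
          (Set.mem_uIcc.2 (.inl ⟨hax.le, hx.1⟩))))
        rw [hpR _ a.2] at this
        exact hax.ne' this
      · by_contra hbx
        have hbx : b.1 < p x := not_le.1 hbx
        have := hpp _ _ ((hp x).subset (Set.uIcc_subset_uIcc_right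
          (Set.mem_uIcc.2 (.inr ⟨hx.2, hbx.le⟩))))
        rw [hpR _ b.2] at this
        exact hbx.ne this
    rw [← Set.uIcc_of_le (show a.1 ≤ b.1 from hab.le)] at hgood
    have := hpp _ _ hgood
    rw [hpR _ a.2, hpR _ b.2] at this
    exact hab.ne (Subtype.ext this)
  · have hsub : Subsingleton R := Cardinal.le_one_iff_subsingleton.1 (not_lt.1 hR)
    rcases isEmpty_or_nonempty L with hE | ⟨⟨a⟩⟩
    · exact hasPowRank_of_countable (Set.to_countable _)
    · refine (HasPowRank.of_uIcc hL (p a)).subset fun x _ => ?_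
      have : p x = p a := congrArg Subtype.val (Subsingleton.elim (⟨p x, x, rfl⟩ : R) ⟨p a, a, rfl⟩)
      exact this ▸ hp x

theorem OmitsPow.image {M : Type u} [LinearOrder M] {n : ℕ} {A : Set M} (h : OmitsPow n A)
    (f : M ↪o L) : OmitsPow n (f '' A) := by
  intro e he heA
  obtain ⟨y, -⟩ := heA (Set.mem_Iio.2 (omega_one_pow_pos n))
  have : Nonempty M := ⟨y⟩
  choose! e' he'A he' using heA
  exact h e' (fun x hx y hy hxy => f.lt_iff_lt.1 (by
    rw [he' hx, he' hy]
    exact he hx hy hxy)) fun x hx => he'A hx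

theorem OmitsPowBoth.image {M : Type u} [LinearOrder M] {n : ℕ} {A : Set M}
    (h : OmitsPowBoth n A) (f : M ↪o L) : OmitsPowBoth n (f '' A) :=
  ⟨h.1.image f, h.2.image f.dual⟩

theorem HasPowRank.of_subtype {X : Set L} (h : HasPowRank (Set.univ : Set X)) :
    HasPowRank X := by
  classical
  obtain ⟨r, hr⟩ := h
  refine ⟨fun x => if hx : x ∈ X then r ⟨x, hx⟩ else 0, fun n => ?_⟩
  refine ((hr n).image (OrderEmbedding.subtype (· ∈ X))).subset ?_
  rintro x ⟨hx, hxn⟩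
  refine ⟨⟨x, hx⟩, ⟨trivial, ?_⟩, rfl⟩
  simpa [hx] using hxn

theorem hasPowRank_univ_of_isPairScattered {τ : OrderType.{u}} (hτ : IsPairScattered ℵ₁ ℵ₁ τ)
    (hcard : τ.card ≤ ℵ₁) : HasPowRank (Set.univ : Set τ.ToType) := by
  obtain ⟨ν, hν, P, hP, hPu⟩ := hτ
  have hL : #τ.ToType ≤ ℵ₁ := by rwa [← OrderType.card_type, OrderType.type_toType]
  have : Countable ν.ord.ToType := by
    rw [← mk_le_aleph0_iff, mk_toType, card_ord]
    exact lt_aleph_one_iff.1 hν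
  rw [← hPu]
  exact .iUnion fun ζ => .of_subtype
    (hasPowRank_univ_of_isScattered ((mk_set_le _).trans hL) (hP ζ))

/-! ### Transfer of the colouring from `ω₁ * ω` -/

theorem OmitsPowBoth.exists_of_finite {r : L → ℕ} {H : Set L}
    (hr : ∀ n, OmitsPowBoth (n + 1) (H ∩ r ⁻¹' {n}))
    (hfin : {n | ¬ (H ∩ r ⁻¹' {n}).Countable}.Finite) : ∃ k, OmitsPowBoth k H := by
  have hbig : ∀ s : Finset ℕ, ∃ k, OmitsPowBoth k (⋃ n ∈ s, H ∩ r ⁻¹' {n}) := by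
    intro s
    induction s using Finset.induction_on with
    | empty => exact ⟨1, omitsPowBoth_of_countable (by simp)⟩
    | insert n s _ ih =>
      obtain ⟨k, hk⟩ := ih
      rw [Finset.set_biUnion_insert]
      exact ⟨_, (hr n).union hk⟩
  have hsmall : (⋃ n ∈ {n | (H ∩ r ⁻¹' {n}).Countable}, H ∩ r ⁻¹' {n}).Countable :=
    (Set.to_countable _).biUnion fun n hn => hn
  obtain ⟨k, hk⟩ := hbig hfin.toFinset
  refine ⟨_, (hk.union (omitsPowBoth_of_countable hsmall)).subset fun x hx => ?_⟩
  by_cases hc : (H ∩ r ⁻¹' {r x}).Countable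
  · exact .inr (Set.mem_biUnion (x := r x) hc ⟨hx, rfl⟩)
  · exact .inl (Set.mem_biUnion (x := r x) (by simpa using hc) ⟨hx, rfl⟩)

theorem nonempty_orderIso_of_type_eq_ordinalType {o : Ordinal.{u}}
    (h : OrderType.type L = ordinalType o) : Nonempty (L ≃o Set.Iio o) := by
  obtain ⟨e⟩ := OrderType.type_eq_type.1 h
  exact ⟨e.trans ToType.mk.symm⟩

theorem type_eq_ordinalType_typeLT [WellFoundedLT L] :
    OrderType.type L = ordinalType (typeLT L) := by
  have h : typeLT (typeLT L).ToType = typeLT L := type_toType _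
  obtain ⟨e⟩ := Ordinal.type_eq.1 h
  exact OrderType.type_congr (OrderIso.ofRelIsoLT e).symm

theorem type_eq_ordinalType_natCast {n : ℕ} (h : #L = n) :
    OrderType.type L = ordinalType n := by
  have : Finite L := by
    rw [← lt_aleph0_iff_finite, h]
    exact natCast_lt_aleph0
  rw [type_eq_ordinalType_typeLT, card_eq_nat.1 ((card_type _).trans h)]

theorem mk_of_type_eq_ordinalType {o : Ordinal.{u}} (h : OrderType.type L = ordinalType o) :
    #L = o.card := by
  rw [← OrderType.card_type, h, ordinalType, OrderType.card_type, mk_toType]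

theorem not_omitsPow_of_type_eq {H : Set L}
    (h : OrderType.type H = ordinalType (ω₁ ^ ω)) (k : ℕ) : ¬ OmitsPow k H := by
  classical
  obtain ⟨e⟩ := nonempty_orderIso_of_type_eq_ordinalType h
  have hk : ∀ x < (ω₁ : Ordinal.{u}) ^ k, x < ω₁ ^ ω := fun x hx => hx.trans_le (by
    rw [← opow_natCast]
    exact opow_le_opow_right (omega_pos 1) (natCast_lt_omega0 k).le)
  intro ho
  refine ho (fun x => if hx : x < ω₁ ^ ω then (e.symm ⟨x, hx⟩).1 else
    (e.symm ⟨0, opow_pos _ (omega_pos 1)⟩).1) (fun x hx y hy hxy => ?_) (fun x hx => ?_)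
  · simp only [hk x hx, hk y hy, dif_pos]
    exact e.symm.strictMono hxy
  · simp only [hk x hx, dif_pos]
    exact (e.symm _).2

theorem not_omitsPowBoth_of_type_mem {H : Set L} (h : OrderType.type H ∈
      ({ordinalType (ω₁ ^ ω), reverse (ordinalType (ω₁ ^ ω))} : Set OrderType.{u})) (k : ℕ) :
    ¬ OmitsPowBoth k H := by
  rintro ⟨h1, h2⟩
  rcases h with h | h
  · exact not_omitsPow_of_type_eq h k h1
  · obtain ⟨e⟩ := OrderType.type_eq_type.1 h
    refine not_omitsPow_of_type_eq (H := OrderDual.ofDual ⁻¹' H) ?_ k h2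
    rw [← OrderType.type_toType (ordinalType (ω₁ ^ ω))]
    exact OrderType.type_congr ((OrderIso.refl _ : (OrderDual.ofDual ⁻¹' H : Set Lᵒᵈ) ≃o Hᵒᵈ).trans
      (e.dual.trans (OrderIso.dualDual _).symm))

/-- Each uncountable colour class pushes all later colours up by another `ω₁`. -/
theorem omega_one_mul_omega0_le_typeLT [WellFoundedLT L] (col : L → ℕ)
    (hcol : ∀ v w, col v < col w → v < w)
    (hinf : {n | ¬ (col ⁻¹' {n}).Countable}.Infinite) : ω₁ * ω ≤ typeLT L := by
  have key : ∀ m : ℕ, ∃ k : ℕ, ∀ w : L, k ≤ col w → ω₁ * m ≤ typein (α := L) (· < ·) w := by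
    intro m
    induction m with
    | zero => exact ⟨0, by simp⟩
    | succ m ih =>
      obtain ⟨k, hk⟩ := ih
      obtain ⟨n, hn, hkn⟩ := hinf.exists_gt k
      -- Otherwise the whole class `n` would inject into the countable gap between `ω₁ * m` and the
      -- position of `w`.
      refine ⟨n + 1, fun w hw => not_lt.1 fun hlt => hn ?_⟩
      rw [Nat.cast_succ, mul_add_one] at hlt
      have hb : typein (α := L) (· < ·) w - ω₁ * m < ω₁ :=
        sub_lt_of_lt_add hlt (omega_pos 1)
      refine Set.MapsTo.countable_of_injOn (f := fun v => typein (α := L) (· < ·) v - ω₁ * m)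
        (fun v hv => ?_) (fun v hv v' hv' hvv => ?_) (countable_Iio_of_lt_omega_one hb)
      · have hv' := hk v (by rw [show col v = n from hv]; exact hkn.le)
        have hvw : typein (α := L) (· < ·) v < typein (α := L) (· < ·) w :=
          (typein_lt_typein _).2 (hcol v w (by rw [show col v = n from hv]; exact hw))
        rw [Set.mem_Iio, lt_sub]
        rwa [Ordinal.add_sub_cancel_of_le hv']
      · have h1 := hk v (by rw [show col v = n from hv]; exact hkn.le)
        have h2 := hk v' (by rw [show col v' = n from hv']; exact hkn.le)
        refine typein_injective (α := L) (· < ·) ?_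
        rw [← Ordinal.add_sub_cancel_of_le h1, ← Ordinal.add_sub_cancel_of_le h2]
        exact congrArg _ hvv
  by_contra hlt
  obtain ⟨n, hn, hlt⟩ := (lt_mul_iff_of_isSuccLimit isSuccLimit_omega0).1 (not_le.1 hlt)
  obtain ⟨n, rfl⟩ := lt_omega0.1 hn
  obtain ⟨k, hk⟩ := key n
  obtain ⟨m, hm, hkm⟩ := hinf.exists_gt k
  obtain ⟨w, hw⟩ : (col ⁻¹' {m}).Nonempty := by
    rw [Set.nonempty_iff_ne_empty]
    intro h
    exact hm (h ▸ Set.countable_empty)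
  exact ((hk w (by rw [show col w = m from hw]; exact hkm.le)).trans_lt
    ((typein_lt_type _ w).trans hlt)).false

theorem type_eq_omega_one_mul_omega0 (φ : L ↪o Set.Iio ((ω₁ : Ordinal.{u}) * ω))
    (hinf : {n : ℕ | ¬ {x | (φ x : Ordinal) / ω₁ = n}.Countable}.Infinite) :
    OrderType.type L = ordinalType (ω₁ * ω) := by
  have : WellFoundedLT L := ⟨φ.ltEmbedding.isWellFounded.wf⟩
  have hdiv : ∀ x, ∃ n : ℕ, (φ x : Ordinal) / ω₁ = n := fun x =>
    lt_omega0.1 ((lt_mul_iff_div_lt (omega_pos 1).ne').1 (φ x).2)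
  choose col hcol using hdiv
  rw [type_eq_ordinalType_typeLT]
  congr 1
  refine le_antisymm ?_ (omega_one_mul_omega0_le_typeLT col (fun v w hvw => ?_) ?_)
  · have h := type_toType (ω₁ * ω : Ordinal.{u})
    rw [← h, type_le_iff']
    exact ⟨OrderEmbedding.ltEmbedding (φ.trans ToType.mk.toOrderEmbedding)⟩
  · by_contra hle
    have := div_le_left (φ.monotone (not_lt.1 hle)) ω₁
    rw [hcol, hcol] at this
    exact (Nat.cast_le.1 this).not_gt hvw
  · convert hinf using 5
    ext x
    simp [hcol]

theorem not_arrow_of_hasPowRank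
    (h : ¬ Arrow (ordinalType.{u} (ω₁ * ω)) ![{ordinalType.{u} (ω₁ * ω)}, {ordinalType.{u} 3}] 2)
    (hL : #L ≤ ℵ₁) (hr : HasPowRank (Set.univ : Set L)) :
    ¬ Arrow (OrderType.type L)
      ![{ordinalType.{u} (ω₁ ^ ω), reverse (ordinalType.{u} (ω₁ ^ ω))}, {ordinalType.{u} 3}] 2 := by
  classical
  intro harrow
  obtain ⟨r, hr⟩ := hr
  obtain ⟨c, hc, hcb⟩ := exists_injective_lt_omega_one hL
  unfold Arrow at h
  push Not at h
  obtain ⟨P, _, hP, f, hf⟩ := h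
  obtain ⟨φ⟩ := nonempty_orderIso_of_type_eq_ordinalType hP
  -- The quotient by `ω₁` recovers the rank `r x`, and the remainder is the code `c x`.
  let g : L → P := fun x =>
    φ.symm ⟨ω₁ * r x + c x, mul_add_lt_mul (natCast_lt_omega0 _) (hcb x)⟩
  have hgφ : ∀ x, (φ (g x) : Ordinal) = ω₁ * r x + c x := fun x => by simp [g]
  have hgr : ∀ x, (φ (g x) : Ordinal) / ω₁ = r x := fun x => by
    rw [hgφ, mul_add_div _ (omega_pos 1).ne', div_eq_zero_of_lt (hcb x), add_zero]
  have hg : Function.Injective g := fun x y hxy => by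
    have h1 := hgr x
    have h2 := hgφ x
    rw [hxy, hgr y] at h1
    rw [hxy, hgφ y, h1] at h2
    exact (hc (add_left_cancel h2)).symm
  obtain ⟨i, Q, hQ, hQf⟩ := harrow L rfl
    fun s => f ⟨s.1.map ⟨g, hg⟩, (Finset.card_map _).trans s.2⟩
  suffices hgQ : OrderType.type (g '' Q) ∈
      (![{ordinalType.{u} (ω₁ * ω)}, {ordinalType.{u} 3}] : Fin 2 → Set OrderType.{u}) i by
    obtain ⟨⟨s, hs2⟩, hs, hne⟩ := hf i (g '' Q) hgQ
    obtain ⟨t, ht, rfl⟩ := Finset.subset_set_image_iff.1 hs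
    have ht2 : t.card = 2 := by rwa [Finset.card_image_of_injective _ hg] at hs2
    refine hne (Eq.trans ?_ (hQf ⟨t, ht2⟩ ht))
    simp only [Finset.map_eq_image]
    rfl
  fin_cases i
  · change OrderType.type (g '' Q) = _
    refine type_eq_omega_one_mul_omega0
      ((OrderEmbedding.subtype _).trans φ.toOrderEmbedding) fun hfin => ?_
    have hfin' : {n | ¬ (Q ∩ r ⁻¹' {n}).Countable}.Finite := by
      refine hfin.subset fun n hn hcount => hn ?_
      refine Set.countable_of_injective_of_countable_image hg.injOn
        ((hcount.image Subtype.val).mono ?_)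
      rintro _ ⟨x, ⟨hx, rfl⟩, rfl⟩
      exact ⟨⟨g x, x, hx, rfl⟩, hgr x, rfl⟩
    obtain ⟨k, hk⟩ := OmitsPowBoth.exists_of_finite
      (fun n => (hr n).subset (Set.inter_subset_inter_left _ (Set.subset_univ _))) hfin'
    exact not_omitsPowBoth_of_type_mem hQ k hk
  · change OrderType.type (g '' Q) = _
    have h3 : #(g '' Q) = (3 : ℕ) := by
      rw [mk_image_eq hg, mk_of_type_eq_ordinalType (show OrderType.type Q = ordinalType 3 from hQ)]
      simp
    simpa using type_eq_ordinalType_natCast h3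

end OrderPartition

end

theorem mainTheorem6
    (h : ¬ OrderPartition.Arrow (OrderPartition.ordinalType.{u} (ω₁ * ω))
      ![{OrderPartition.ordinalType.{u} (ω₁ * ω)}, {OrderPartition.ordinalType.{u} 3}] 2)
    (τ : OrderType.{u})
    (hτ : OrderPartition.IsPairScattered ℵ₁ ℵ₁ τ)
    (hcard : τ.card ≤ ℵ₁) :
    ¬ OrderPartition.Arrow τ
      ![{OrderPartition.ordinalType.{u} (ω₁ ^ ω),
          OrderPartition.reverse (OrderPartition.ordinalType.{u} (ω₁ ^ ω))},
        {OrderPartition.ordinalType.{u} 3}] 2 := by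
  have := OrderPartition.not_arrow_of_hasPowRank h (L := τ.ToType)
    (by rwa [← OrderType.card_type, OrderType.type_toType])
    (OrderPartition.hasPowRank_univ_of_isPairScattered hτ hcard)
  rwa [OrderType.type_toType] at this
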